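/- Let $d\ge 0$ be an integer and let $\omega$ be a positive quadratic form on $\mathbb R^d$, i.e. a real quadratic form with $\omega(x)\ge 0$ for all $x\in\mathbb R^d$ which is not identically zero (in particular, any positive definite form if $d\ge 1$). For $g\in L^2(\mathbb R^d)$ (complex-valued, Lebesgue measure) and $m,n\in\mathbb Z^d$ put $$g_{m,n}(x)=e^{2\pi i\, n\cdot x}\,g(x-m).$$ Suppose that the family $\{g_{m,n}: m,n\in\mathbb Z^d\}$ is an exact frame for $L^2(\mathbb R^d)$: there are constants $0<A\le B<\infty$ with $$A\|f\|_2^2\le\sum_{m,n\in\mathbb Z^d}|\langle f,g_{m,n}\rangle|^2\le B\|f\|_2^2\qquad\text{for all } f\in L^2(\mathbb R^d),$$ and the family is no longer a frame (that is, no such constants exist for it) after removal of any one of its elements. Then $$\left(\int_{\mathbb R^d}\omega(x)\,|g(x)|^2\,dx\right)\left(\int_{\mathbb R^d}\omega(\xi)\,|\hat g(\xi)|^2\,d\xi\right)=\infty ,$$ where $\hat g$ is the Fourier transform of $g$, the unitary extension to $L^2(\mathbb R^d)$ of $\hat g(\xi)=\int_{\mathbb R^d} g(x)e^{2\pi i x\cdot\xi}\,dx$.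 The integrals and their product take values in $[0,\infty]$ with $0\cdot\infty=0$; in particular both factors are positive and at least one of them is infinite. -/

import Mathlib

open MeasureTheory
open scoped ENNReal FourierTransform

/-- A family `f` of vectors of a complex inner product space is a frame if there are frame bounds
`0 < A` and `0 < B` with `A ‖x‖² ≤ ∑ₖ |⟨x, fₖ⟩|² ≤ B ‖x‖²` for every `x`; the convergence of the
series is part of the definition. -/
def IsFrame {ι H : Type*} [NormedAddCommGroup H] [InnerProductSpace ℂ H] (f : ι → H) : Prop :=
  ∃ A B : ℝ, 0 < A ∧ 0 < B ∧ ∀ x : H,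
    Summable (fun k => ‖inner ℂ (f k) x‖ ^ 2) ∧
      A * ‖x‖ ^ 2 ≤ ∑' k, ‖inner ℂ (f k) x‖ ^ 2 ∧
      ∑' k, ‖inner ℂ (f k) x‖ ^ 2 ≤ B * ‖x‖ ^ 2

/-- A frame is exact if it is no longer a frame after removal of any of its elements. -/
def IsExactFrame {ι H : Type*} [NormedAddCommGroup H] [InnerProductSpace ℂ H]
    (f : ι → H) : Prop :=
  IsFrame f ∧ ∀ k : ι, ¬ IsFrame (fun j : {j : ι // j ≠ k} => f j)

/-- The Hilbert space `L²(ℝᵈ)` of complex-valued functions, for Lebesgue measure. -/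
abbrev L2Space (d : ℕ) : Type :=
  Lp ℂ 2 (volume : Measure (EuclideanSpace ℝ (Fin d)))

/-- The pointwise formula `x ↦ e^{2πi n·x} g(x - m)`. -/
noncomputable def gaborFun {d : ℕ} (g : EuclideanSpace ℝ (Fin d) → ℂ)
    (m n : EuclideanSpace ℝ (Fin d)) (x : EuclideanSpace ℝ (Fin d)) : ℂ :=
  Complex.exp (2 * Real.pi * Complex.I * ((inner ℝ n x : ℝ) : ℂ)) * g (x - m)

theorem memLp_gaborFun {d : ℕ} (g : L2Space d) (m n : EuclideanSpace ℝ (Fin d)) :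
    MemLp (gaborFun g m n) 2 (volume : Measure (EuclideanSpace ℝ (Fin d))) := by
  have h : MemLp (fun x => g (x - m)) 2 (volume : Measure (EuclideanSpace ℝ (Fin d))) :=
    (Lp.memLp g).comp_measurePreserving (measurePreserving_sub_right volume m)
  have hc : Continuous (fun x : EuclideanSpace ℝ (Fin d) =>
      Complex.exp (2 * Real.pi * Complex.I * ((inner ℝ n x : ℝ) : ℂ))) := by
    fun_prop
  refine h.congr_norm (hc.aestronglyMeasurable.mul h.aestronglyMeasurable) ?_
  refine Filter.Eventually.of_forall fun x => ?_
  have e : (2 * Real.pi * Complex.I * ((inner ℝ n x : ℝ) : ℂ)) =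
      ((2 * Real.pi * inner ℝ n x : ℝ) : ℂ) * Complex.I := by
    push_cast; ring
  rw [gaborFun, norm_mul, e, Complex.norm_exp_ofReal_mul_I, one_mul]

/-- The time-frequency shift of `g ∈ L²(ℝᵈ)`, the class in `L²(ℝᵈ)` of
`x ↦ e^{2πi n·x} g(x - m)`. -/
noncomputable def timeFreqShift {d : ℕ} (g : L2Space d) (m n : EuclideanSpace ℝ (Fin d)) :
    L2Space d :=
  (memLp_gaborFun g m n).toLp (gaborFun g m n)

/-- An integer vector as a point of `ℝᵈ`. -/
noncomputable def intVec {d : ℕ} (m : Fin d → ℤ) : EuclideanSpace ℝ (Fin d) :=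
  WithLp.toLp 2 (fun i => (m i : ℝ))

/-- The Gabor system `{g_{m,n} : m, n ∈ ℤᵈ}` generated by `g`, as an indexed family. -/
noncomputable def gaborSystem {d : ℕ} (g : L2Space d) :
    (Fin d → ℤ) × (Fin d → ℤ) → L2Space d :=
  fun p => timeFreqShift g (intVec p.1) (intVec p.2)

/-- The Fourier transform `ĝ(ξ) = ∫ g(x) e^{2πi x·ξ} dx`, extended to a unitary map of `L²(ℝᵈ)`.
With this positive sign in the exponent it is what Mathlib calls the inverse transform `𝓕⁻`. -/
noncomputable def fourierL2 {d : ℕ} (g : L2Space d) : L2Space d := 𝓕⁻ g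

/-- The weighted integral `∫ ω(x) |f(x)|² dx` in `[0, ∞]`, for a form `ω` with nonnegative
values. -/
noncomputable def weightedEnergy {d : ℕ} (ω : QuadraticForm ℝ (EuclideanSpace ℝ (Fin d)))
    (f : L2Space d) : ℝ≥0∞ :=
  ∫⁻ x, ENNReal.ofReal (ω x * ‖f x‖ ^ 2)

/-! ### Frame operators and the biorthogonality of exact frames -/

section Frames

variable {ι H : Type*} [NormedAddCommGroup H] [InnerProductSpace ℂ H]

/-! This is Battle's commutator argument for Balian–Low, run with finite differences. Integer
time-frequency shifts commute, so they form a unitary representation `U` of ℤᵈ × ℤᵈ, and the frame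
operator commutes with it. The dual frame of an exact Gabor frame is therefore the orbit of one
vector γ, biorthogonal to the orbit of g (`IsExactFrame.exists_isDualWindow`).

A nonzero form ω ≥ 0 dominates ⟨v, x⟩² for some v ≠ 0 (`QuadraticForm.exists_inner_sq_le`), so one
direction suffices. Let V_s and W_s be modulation and translation by sv. If both energies were
finite, V_s g would be differentiable at s = 0 and W_s g − g would be O(s); by duality W_s* γ − γ is
O(s) too.

Now ⟨γ, (V_s W_s − W_s V_s) g⟩ is computed twice. The Weyl relation makes it asymptotic to 2πi|v|²
s², since ⟨γ, g⟩ = 1. On the other hand it equals ⟨V_s* γ − γ, W_s g − g⟩ − ⟨W_s* γ − γ, V_s g − g⟩.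
Both products expand in the frame, and after k ↦ −k the two series agree termwise up to phases
tending to 1 (`IsDualWindow.hasSum_inner_commutator`). Cauchy–Schwarz and dominated convergence make
the difference o(s²), a contradiction (`IsDualWindow.false_of_commutator`). -/

theorem HasSum.norm_sq_le_tsum_mul_tsum {u w : ι → ℂ} {z : ℂ} (h : HasSum (fun k => u k * w k) z)
    (hu : Summable fun k => ‖u k‖ ^ 2) (hw : Summable fun k => ‖w k‖ ^ 2) :
    ‖z‖ ^ 2 ≤ (∑' k, ‖u k‖ ^ 2) * ∑' k, ‖w k‖ ^ 2 := by
  refine le_of_tendsto ((h.norm).pow 2) (Filter.Eventually.of_forall fun s => ?_)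
  calc ‖∑ k ∈ s, u k * w k‖ ^ 2 ≤ (∑ k ∈ s, ‖u k‖ * ‖w k‖) ^ 2 := by
        gcongr
        exact (norm_sum_le _ _).trans_eq (by simp)
    _ ≤ (∑ k ∈ s, ‖u k‖ ^ 2) * ∑ k ∈ s, ‖w k‖ ^ 2 := Finset.sum_mul_sq_le_sq_mul_sq _ _ _
    _ ≤ _ := by
        gcongr
        · exact hu.sum_le_tsum _ fun _ _ => by positivity
        · exact hw.sum_le_tsum _ fun _ _ => by positivity

theorem HasSum.subtype_ne {E : Type*} [NormedAddCommGroup E] {u : ι → E} {z : E}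
    (h : HasSum u z) (k : ι) : HasSum (fun j : {j : ι // j ≠ k} => u j) (z - u k) := by
  classical
  have h1 : HasSum (fun j => u j - if j = k then u k else 0) (z - u k) :=
    h.sub (hasSum_ite_eq k (u k))
  refine (hasSum_subtype_iff_indicator (s := {j | j ≠ k})).2 ?_
  convert! h1 using 2 with j
  by_cases hj : j = k <;> simp [Set.indicator, hj]

/-- S = C*C for the analysis operator C into ℓ². The lower frame bound makes S bounded below, and a
self-adjoint operator bounded below is invertible. -/
theorem IsFrame.exists_frameOperator [CompleteSpace H] {f : ι → H} (hf : IsFrame f) :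
    ∃ S : H ≃L[ℂ] H, ∀ x y, HasSum (fun k => inner ℂ x (f k) * inner ℂ (f k) y)
      (inner ℂ (S x) y) := by
  obtain ⟨A, B, hA, hB, h⟩ := hf
  have hmem : ∀ x : H, Memℓp (fun k => inner ℂ (f k) x : ι → ℂ) 2 := fun x =>
    memℓp_gen (by simpa using (h x).1)
  let C₀ : H →ₗ[ℂ] lp (fun _ : ι => ℂ) 2 :=
    { toFun := fun x => ⟨fun k => inner ℂ (f k) x, hmem x⟩
      map_add' := fun x y => by ext k; exact inner_add_right _ _ _
      map_smul' := fun c x => by ext k; exact inner_smul_right _ _ _ }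
  have hnorm : ∀ x, ‖C₀ x‖ ^ 2 = ∑' k, ‖inner ℂ (f k) x‖ ^ 2 := fun x => by
    have := lp.norm_rpow_eq_tsum (p := 2) (by norm_num) (C₀ x)
    simpa [C₀] using this
  let C : H →L[ℂ] lp (fun _ : ι => ℂ) 2 := C₀.mkContinuous (√B) fun x => by
    refine le_of_pow_le_pow_left₀ two_ne_zero (by positivity) ?_
    rw [hnorm, mul_pow, Real.sq_sqrt hB.le]
    exact (h x).2.2
  let S : H →L[ℂ] H := C.adjoint ∘L C
  have hS : ∀ x y, inner ℂ (S x) y = inner ℂ (C x) (C y) := fun x y => by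
    simp [S, ContinuousLinearMap.adjoint_inner_left]
  have hbelow : ∀ x, A * ‖x‖ ≤ ‖S x‖ := fun x => by
    rcases eq_or_ne x 0 with rfl | hx
    · simp
    have hx' : 0 < ‖x‖ := norm_pos_iff.2 hx
    have h1 : A * ‖x‖ ^ 2 ≤ ‖C x‖ ^ 2 := (h x).2.1.trans_eq (hnorm x).symm
    have h2 : ‖C x‖ ^ 2 ≤ ‖S x‖ * ‖x‖ := by
      have := norm_inner_le_norm (𝕜 := ℂ) (S x) x
      rwa [hS, inner_self_eq_norm_sq_to_K, norm_pow, RCLike.norm_ofReal,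
        abs_of_nonneg (norm_nonneg _)] at this
    nlinarith
  have hanti : AntilipschitzWith (Real.toNNReal A⁻¹) S :=
    AddMonoidHomClass.antilipschitz_of_bound S fun x => by
      rw [Real.coe_toNNReal _ (inv_nonneg.2 hA.le), inv_mul_eq_div, le_div_iff₀ hA, mul_comm]
      exact hbelow x
  have hadj : S.adjoint = S := by
    simp [S, ContinuousLinearMap.adjoint_comp]
  have hclosed : IsClosed (S.range : Set H) :=
    hanti.isClosed_range S.uniformContinuous
  have hker : S.ker = ⊥ := LinearMap.ker_eq_bot.2 hanti.injective
  -- The range is closed, and its orthogonal complement is the kernel of S* = S, which is trivial.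
  have hrange : S.range = ⊤ := by
    have := hclosed.completeSpace_coe
    rw [← Submodule.orthogonal_orthogonal S.range, ContinuousLinearMap.orthogonal_range, hadj,
      hker, Submodule.bot_orthogonal_eq_top]
  refine ⟨ContinuousLinearEquiv.ofBijective S hker hrange, fun x y => ?_⟩
  rw [ContinuousLinearEquiv.coeFn_ofBijective, hS]
  have := lp.hasSum_inner (𝕜 := ℂ) (C x) (C y)
  refine this.congr_fun fun k => ?_
  change _ = inner ℂ (inner ℂ (f k) x) (inner ℂ (f k) y)
  rw [RCLike.inner_apply, inner_conj_symm, mul_comm]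

theorem frameOperator_symm {f : ι → H} {S : H ≃L[ℂ] H}
    (hS : ∀ x y, HasSum (fun k => inner ℂ x (f k) * inner ℂ (f k) y) (inner ℂ (S x) y))
    (x y : H) : inner ℂ (S x) y = inner ℂ x (S y) := by
  rw [← inner_conj_symm x (S y)]
  refine (hS x y).unique ?_
  convert! (hS y x).star using 2 with k
  simp [mul_comm]

/-- An exact frame is biorthogonal to its canonical dual frame. -/
theorem IsExactFrame.inner_frameOperator_symm [DecidableEq ι] {f : ι → H}
    (hf : IsExactFrame f) {S : H ≃L[ℂ] H}
    (hS : ∀ x y, HasSum (fun k => inner ℂ x (f k) * inner ℂ (f k) y) (inner ℂ (S x) y))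
    (k j : ι) : inner ℂ (S.symm (f k)) (f j) = if j = k then 1 else 0 := by
  obtain ⟨⟨A, B, hA, hB, h⟩, hex⟩ := hf
  have hc : Summable fun j => ‖inner ℂ (S.symm (f k)) (f j)‖ ^ 2 := by
    simpa only [norm_inner_symm] using (h (S.symm (f k))).1
  have hone : inner ℂ (S.symm (f k)) (f k) = 1 := by
    by_contra hne
    set a := inner ℂ (S.symm (f k)) (f k) with ha
    have hpos : 0 < ‖1 - a‖ ^ 2 := by
      have : 0 < ‖1 - a‖ := norm_pos_iff.2 (sub_ne_zero.2 (Ne.symm hne))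
      positivity
    set M := ∑' j : {j : ι // j ≠ k}, ‖inner ℂ (S.symm (f k)) (f j)‖ ^ 2 with hM
    have hM0 : 0 ≤ M := tsum_nonneg fun _ => by positivity
    -- If a ≠ 1, the dual expansion of f_k can be solved for f_k in terms of the other elements. The
    -- lost term |⟨f_k, x⟩|² is then at most M / |1 − a|² times the remaining sum, so the remaining
    -- family would still be a frame.
    refine hex k ⟨A / (1 + M / ‖1 - a‖ ^ 2), B, by positivity, hB, fun x => ?_⟩
    have hsum := (h x).1.hasSum.subtype_ne k
    have hle : ‖inner ℂ (f k) x‖ ^ 2 * ‖1 - a‖ ^ 2 ≤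
        M * ∑' j : {j : ι // j ≠ k}, ‖inner ℂ (f j) x‖ ^ 2 := by
      have h1 := (hS (S.symm (f k)) x).subtype_ne k
      rw [S.apply_symm_apply] at h1
      have h2 := h1.norm_sq_le_tsum_mul_tsum (hc.hasSum.subtype_ne k).summable hsum.summable
      rwa [← ha, show inner ℂ (f k) x - a * inner ℂ (f k) x = inner ℂ (f k) x * (1 - a) by ring,
        norm_mul, mul_pow] at h2
    refine ⟨hsum.summable, ?_, ?_⟩
    · set T := ∑' j : {j : ι // j ≠ k}, ‖inner ℂ (f j) x‖ ^ 2 with hT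
      have h3 : T = ∑' j, ‖inner ℂ (f j) x‖ ^ 2 - ‖inner ℂ (f k) x‖ ^ 2 := hsum.tsum_eq
      have h4 := (h x).2.1
      have h5 : ‖inner ℂ (f k) x‖ ^ 2 ≤ M * T / ‖1 - a‖ ^ 2 := (le_div_iff₀ hpos).2 hle
      rw [div_mul_eq_mul_div, div_le_iff₀ (by positivity)]
      calc A * ‖x‖ ^ 2 ≤ T + ‖inner ℂ (f k) x‖ ^ 2 := by linarith
        _ ≤ T + M * T / ‖1 - a‖ ^ 2 := by linarith
        _ = _ := by ring
    · rw [hsum.tsum_eq]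
      linarith [(h x).2.2, sq_nonneg ‖inner ℂ (f k) x‖]
  split_ifs with hjk
  · rw [hjk, hone]
  -- The squared coefficients sum to ⟨f_k, S⁻¹ f_k⟩ = 1, and the k-th alone is already 1; all others
  -- must vanish.
  have h1 : HasSum (fun j => ‖inner ℂ (S.symm (f k)) (f j)‖ ^ 2) 1 := by
    have h2 := hS (S.symm (f k)) (S.symm (f k))
    rw [S.apply_symm_apply, ← inner_conj_symm, hone, map_one] at h2
    have h3 := Complex.hasSum_re h2
    convert! h3 using 2 with j
    rw [← inner_conj_symm (f j), Complex.mul_conj, Complex.normSq_eq_norm_sq, Complex.ofReal_re]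
  have h4 := h1.subtype_ne k
  rw [hone, norm_one, one_pow, sub_self] at h4
  have h5 := (hasSum_zero_iff_of_nonneg fun _ => by positivity).1 h4
  simpa using congrFun h5 ⟨j, hjk⟩

end Frames

/-! ### Dual windows and the abstract Balian–Low argument -/

section DualWindow

variable {G H : Type*} [AddCommGroup G] [NormedAddCommGroup H] [InnerProductSpace ℂ H]

/-- `U` is a unitary representation of `G`, and the orbits of `g` and `d` are biorthogonal dual
frames with frame constant `K`. -/
structure IsDualWindow (U : G → H ≃ₗᵢ[ℂ] H) (g d : H) (K : ℝ) : Prop where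
  map_add : ∀ a b x, U (a + b) x = U a (U b x)
  pos : 0 < K
  inner_zero : inner ℂ d g = 1
  inner_ne : ∀ a, a ≠ 0 → inner ℂ d (U a g) = 0
  hasSum_inner : ∀ x y, HasSum (fun a => inner ℂ x (U a g) * inner ℂ (U a d) y) (inner ℂ x y)
  summable : ∀ x, Summable fun a => ‖inner ℂ (U a g) x‖ ^ 2
  norm_sq_le : ∀ x, ‖x‖ ^ 2 ≤ K * ∑' a, ‖inner ℂ (U a g) x‖ ^ 2
  tsum_le : ∀ x, ∑' a, ‖inner ℂ (U a g) x‖ ^ 2 ≤ K * ‖x‖ ^ 2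
  summable_dual : ∀ x, Summable fun a => ‖inner ℂ (U a d) x‖ ^ 2
  tsum_dual_le : ∀ x, ∑' a, ‖inner ℂ (U a d) x‖ ^ 2 ≤ K * ‖x‖ ^ 2

/-- The frame operator commutes with `U`, so S⁻¹ carries the orbit of g to the orbit of S⁻¹ g. -/
theorem IsExactFrame.exists_isDualWindow [CompleteSpace H] {U : G → H ≃ₗᵢ[ℂ] H}
    (hU : ∀ a b x, U (a + b) x = U a (U b x)) {g : H} (hg : IsExactFrame fun a => U a g) :
    ∃ d K, IsDualWindow U g d K := by
  classical
  obtain ⟨S, hS⟩ := hg.1.exists_frameOperator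
  have hbi := hg.inner_frameOperator_symm hS
  have hsymm := frameOperator_symm hS
  have hsymm' : ∀ x y, inner ℂ (S.symm x) y = inner ℂ x (S.symm y) := fun x y => by
    conv_lhs => rw [← S.apply_symm_apply y]
    rw [← hsymm, S.apply_symm_apply]
  obtain ⟨A, B, hA, hB, h⟩ := hg.1
  have hU0 : ∀ x, U 0 x = x := fun x => (U 0).injective (by rw [← hU, add_zero])
  have hcomm : ∀ b x, S (U b x) = U b (S x) := fun b x => by
    refine ext_inner_right ℂ fun y => ?_
    refine (hS (U b x) y).unique ?_
    have h1 := hS x ((U b).symm y)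
    rw [← (U b).inner_map_map, (U b).apply_symm_apply] at h1
    -- The orbit is invariant under `U b`; translating the index by b matches the two series.
    rw [← (Equiv.addLeft b).hasSum_iff]
    refine h1.congr_fun fun a => ?_
    simp only [Function.comp_apply, Equiv.coe_addLeft, hU, (U b).inner_map_map]
    congr 1
    rw [← (U b).inner_map_map (U a g), (U b).apply_symm_apply]
  have hd : ∀ a, U a (S.symm g) = S.symm (U a g) := fun a =>
    S.injective (by rw [hcomm, S.apply_symm_apply, S.apply_symm_apply])
  set N := ‖(S.symm : H →L[ℂ] H)‖ with hN
  have hdual : ∀ a x, inner ℂ (U a (S.symm g)) x = inner ℂ (U a g) (S.symm x) := fun a x => by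
    rw [hd, hsymm']
  -- One constant for three bounds: A⁻¹ serves the lower bound, B the upper bound, and B N² the
  -- upper bound for the dual orbit.
  have hK : 0 < A⁻¹ + B + B * N ^ 2 := by positivity
  refine ⟨S.symm g, A⁻¹ + B + B * N ^ 2, hU, hK, ?_, fun a ha => ?_, fun x y => ?_,
    fun x => (h x).1, fun x => ?_, fun x => ?_, fun x => ?_, fun x => ?_⟩
  · simpa [hU0] using hbi 0 0
  · simpa [hU0, ha] using hbi 0 a
  · have h1 := hS x (S.symm y)
    rw [hsymm, S.apply_symm_apply] at h1
    exact h1.congr_fun fun a => by rw [hdual]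
  · have h1 := (h x).2.1
    have h0 : 0 ≤ ∑' a, ‖inner ℂ (U a g) x‖ ^ 2 := tsum_nonneg fun _ => by positivity
    have h2 : ‖x‖ ^ 2 ≤ A⁻¹ * ∑' a, ‖inner ℂ (U a g) x‖ ^ 2 := by
      rwa [inv_mul_eq_div, le_div_iff₀ hA, mul_comm]
    have h3 : 0 ≤ (B + B * N ^ 2) * ∑' a, ‖inner ℂ (U a g) x‖ ^ 2 := by positivity
    linarith
  · have h3 : 0 ≤ (A⁻¹ + B * N ^ 2) * ‖x‖ ^ 2 := by positivity
    linarith [(h x).2.2]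
  · simpa only [hdual] using (h (S.symm x)).1
  · simp only [hdual]
    have h1 := (h (S.symm x)).2.2
    have h2 : ‖S.symm x‖ ^ 2 ≤ (N * ‖x‖) ^ 2 := by
      gcongr
      exact (S.symm : H →L[ℂ] H).le_opNorm x
    have h3 : 0 ≤ (A⁻¹ + B) * ‖x‖ ^ 2 := by positivity
    have h4 := mul_le_mul_of_nonneg_left h2 hB.le
    linarith

namespace IsDualWindow

variable {U : G → H ≃ₗᵢ[ℂ] H} {g d : H} {K : ℝ}

theorem map_zero (h : IsDualWindow U g d K) (x : H) : U 0 x = x :=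
  (U 0).injective (by rw [← h.map_add, add_zero])

theorem inner_map_left (h : IsDualWindow U g d K) (a : G) (x y : H) :
    inner ℂ (U a x) y = inner ℂ x (U (-a) y) := by
  rw [← (U a).inner_map_map x, ← h.map_add, add_neg_cancel, h.map_zero]

/-- Biorthogonality enters here: a phase equal to 1 at the origin is invisible to these
coefficients. -/
theorem phase_mul_inner (h : IsDualWindow U g d K) {c : G → ℂ} (hc : c 0 = 1) (a : G) :
    c a * inner ℂ d (U a g) = inner ℂ d (U a g) := by
  rcases eq_or_ne a 0 with rfl | ha
  · rw [hc, one_mul]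
  · rw [h.inner_ne a ha, mul_zero]

/-- This transfers a difference from the dual window to the window. Moving V across the inner
product costs the phase c a, and the subtracted term may carry the same phase by `phase_mul_inner`.
-/
theorem inner_sub_of_commute (h : IsDualWindow U g d K) {V : H ≃ₗᵢ[ℂ] H} {c : G → ℂ}
    (hc : c 0 = 1) (hV : ∀ a x, V (U a x) = c a • U a (V x)) (a : G) :
    inner ℂ (V.symm d - d) (U a g) = c a * inner ℂ (U (-a) d) (V g - g) := by
  have h1 : inner ℂ (V.symm d) (U a g) = c a * inner ℂ d (U a (V g)) := by
    rw [← V.inner_map_map, V.apply_symm_apply, hV, inner_smul_right]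
  have h2 : inner ℂ (U (-a) d) (V g - g) = inner ℂ d (U a (V g)) - inner ℂ d (U a g) := by
    rw [h.inner_map_left, neg_neg, _root_.map_sub, inner_sub_right]
  rw [inner_sub_left, h1, h2, mul_sub, h.phase_mul_inner hc]

/-- Regularity of the window under a commuting family passes to the dual window. -/
theorem norm_map_sub_le (h : IsDualWindow U g d K) {V : H ≃ₗᵢ[ℂ] H} {c : G → ℂ}
    (hc : c 0 = 1) (hc1 : ∀ a, ‖c a‖ = 1) (hV : ∀ a x, V (U a x) = c a • U a (V x)) :
    ‖V.symm d - d‖ ≤ K * ‖V g - g‖ := by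
  refine le_of_pow_le_pow_left₀ two_ne_zero (mul_nonneg h.pos.le (norm_nonneg _)) ?_
  have h1 : ∑' a, ‖inner ℂ (U a g) (V.symm d - d)‖ ^ 2 = ∑' a, ‖inner ℂ (U a d) (V g - g)‖ ^ 2 := by
    rw [← (Equiv.neg G).tsum_eq fun a => ‖inner ℂ (U a d) (V g - g)‖ ^ 2]
    congr 1 with a
    rw [norm_inner_symm, h.inner_sub_of_commute hc hV, norm_mul, hc1, one_mul]
    rfl
  calc ‖V.symm d - d‖ ^ 2 ≤ K * ∑' a, ‖inner ℂ (U a d) (V g - g)‖ ^ 2 := h1 ▸ h.norm_sq_le _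
    _ ≤ K * (K * ‖V g - g‖ ^ 2) := mul_le_mul_of_nonneg_left (h.tsum_dual_le _) h.pos.le
    _ = _ := by ring

/-- The commutator is the antisymmetrization in V and W of ⟨V* d − d, W g − g⟩, the lower-order
terms cancelling. Transferring differences by `inner_sub_of_commute` shows that the two frame
expansions differ, term by term, only by the factor a(−k) b(−k). -/
theorem hasSum_inner_commutator (h : IsDualWindow U g d K) {V W : H ≃ₗᵢ[ℂ] H} {a b : G → ℂ}
    (ha : a 0 = 1) (hb : b 0 = 1) (hbn : ∀ k, b k * b (-k) = 1)
    (hV : ∀ k x, V (U k x) = a k • U k (V x)) (hW : ∀ k x, W (U k x) = b k • U k (W x)) :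
    HasSum (fun k => inner ℂ (W.symm d - d) (U k g) *
        ((a (-k) * b (-k) - 1) * inner ℂ (U k d) (V g - g)))
      (inner ℂ d (V (W g) - W (V g))) := by
  have key : ∀ (V W : H ≃ₗᵢ[ℂ] H), inner ℂ (V.symm d - d) (W g - g) =
      inner ℂ d (V (W g) - V g - W g + g) := fun V W => by
    have : ∀ y, inner ℂ (V.symm d) y = inner ℂ d (V y) := fun y => by
      rw [← V.inner_map_map, V.apply_symm_apply]
    simp only [inner_sub_left, inner_sub_right, inner_add_right, this]
    ring
  have h1 := h.hasSum_inner (W.symm d - d) (V g - g)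
  have h2 := h.hasSum_inner (V.symm d - d) (W g - g)
  rw [← (Equiv.neg G).hasSum_iff] at h2
  have h3 := h2.sub h1
  rw [key, key, ← inner_sub_right, show V (W g) - V g - W g + g - (W (V g) - W g - V g + g) =
    V (W g) - W (V g) by abel] at h3
  refine h3.congr_fun fun k => ?_
  simp only [Function.comp_apply, Equiv.neg_apply]
  rw [h.inner_sub_of_commute ha hV, neg_neg, h.inner_sub_of_commute hb hW k]
  linear_combination (inner ℂ (U (-k) d) (W g - g)) * inner ℂ (U k d) (V g - g) * a (-k) * hbn k

/-- The vector p is to be the linear part of V g − g. It isolates a series to which dominated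
convergence applies, leaving a remainder that needs only the bound 4 on the squared phase defect. -/
theorem norm_inner_commutator_sq_le (h : IsDualWindow U g d K) {V W : H ≃ₗᵢ[ℂ] H} {a b : G → ℂ}
    (ha : a 0 = 1) (hb : b 0 = 1) (ha1 : ∀ k, ‖a k‖ = 1) (hb1 : ∀ k, ‖b k‖ = 1)
    (hbn : ∀ k, b k * b (-k) = 1)
    (hV : ∀ k x, V (U k x) = a k • U k (V x)) (hW : ∀ k x, W (U k x) = b k • U k (W x)) (p : H) :
    ‖inner ℂ d (V (W g) - W (V g))‖ ^ 2 ≤ K ^ 3 * ‖W g - g‖ ^ 2 *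
      (2 * ∑' k, ‖a (-k) * b (-k) - 1‖ ^ 2 * ‖inner ℂ (U k d) p‖ ^ 2 +
        8 * K * ‖V g - g - p‖ ^ 2) := by
  have hph : ∀ k, ‖a (-k) * b (-k) - 1‖ ^ 2 ≤ 4 := fun k => by
    have h1 : ‖a (-k) * b (-k) - 1‖ ≤ 2 := (norm_sub_le _ _).trans (by
      rw [norm_mul, ha1, hb1, norm_one]; norm_num)
    nlinarith [norm_nonneg (a (-k) * b (-k) - 1)]
  have hs : ∀ x, Summable fun k => ‖a (-k) * b (-k) - 1‖ ^ 2 * ‖inner ℂ (U k d) x‖ ^ 2 := fun x =>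
    Summable.of_nonneg_of_le (fun k => by positivity)
      (fun k => mul_le_mul_of_nonneg_right (hph k) (by positivity))
      ((h.summable_dual x).mul_left 4)
  have hsum : Summable fun k => ‖inner ℂ (W.symm d - d) (U k g)‖ ^ 2 := by
    simpa only [norm_inner_symm] using h.summable (W.symm d - d)
  have h1 := (h.hasSum_inner_commutator ha hb hbn hV hW).norm_sq_le_tsum_mul_tsum hsum
    (by simpa only [norm_mul, mul_pow] using hs (V g - g))
  have h2 : ∑' k, ‖inner ℂ (W.symm d - d) (U k g)‖ ^ 2 ≤ K * (K * ‖W g - g‖) ^ 2 := by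
    simp only [norm_inner_symm _ (U _ g)]
    refine (h.tsum_le _).trans (mul_le_mul_of_nonneg_left ?_ h.pos.le)
    gcongr
    exact h.norm_map_sub_le hb hb1 hW
  have h3 : ∑' k, ‖(a (-k) * b (-k) - 1) * inner ℂ (U k d) (V g - g)‖ ^ 2 ≤
      2 * ∑' k, ‖a (-k) * b (-k) - 1‖ ^ 2 * ‖inner ℂ (U k d) p‖ ^ 2 +
        8 * K * ‖V g - g - p‖ ^ 2 := by
    -- Here 8 = 4 · 2: the bound on the squared phase defect times the 2 from (x + y)² ≤ 2x² + 2y².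
    have h4 : 8 * ∑' k, ‖inner ℂ (U k d) (V g - g - p)‖ ^ 2 ≤ 8 * K * ‖V g - g - p‖ ^ 2 := by
      rw [mul_assoc]
      exact mul_le_mul_of_nonneg_left (h.tsum_dual_le _) (by norm_num)
    refine le_trans ?_ (add_le_add_right h4 _)
    rw [← tsum_mul_left, ← tsum_mul_left, ← ((hs p).mul_left 2).tsum_add
      ((h.summable_dual (V g - g - p)).mul_left 8)]
    refine Summable.tsum_le_tsum (fun k => ?_)
      (by simpa only [norm_mul, mul_pow] using hs (V g - g))
      (((hs p).mul_left 2).add ((h.summable_dual (V g - g - p)).mul_left 8))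
    have h5 : ‖inner ℂ (U k d) (V g - g)‖ ≤
        ‖inner ℂ (U k d) p‖ + ‖inner ℂ (U k d) (V g - g - p)‖ := by
      refine le_of_eq_of_le ?_ (norm_add_le _ _)
      rw [← inner_add_right, add_sub_cancel]
    have h6 : ‖inner ℂ (U k d) (V g - g)‖ ^ 2 ≤
        2 * ‖inner ℂ (U k d) p‖ ^ 2 + 2 * ‖inner ℂ (U k d) (V g - g - p)‖ ^ 2 := by
      nlinarith [sq_nonneg (‖inner ℂ (U k d) p‖ - ‖inner ℂ (U k d) (V g - g - p)‖),
        norm_nonneg (inner ℂ (U k d) (V g - g))]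
    rw [norm_mul, mul_pow]
    calc _ ≤ ‖a (-k) * b (-k) - 1‖ ^ 2 *
          (2 * ‖inner ℂ (U k d) p‖ ^ 2 + 2 * ‖inner ℂ (U k d) (V g - g - p)‖ ^ 2) := by gcongr
      _ ≤ _ := by nlinarith [hph k, sq_nonneg ‖inner ℂ (U k d) (V g - g - p)‖]
  calc _ ≤ _ := h1
    _ ≤ (K * (K * ‖W g - g‖) ^ 2) * _ := mul_le_mul h2 h3 (tsum_nonneg fun _ => by positivity)
        (by have := h.pos; positivity)
    _ = _ := by ring

open Filter Topology in
/-- Abstract Balian–Low theorem: a dual window excludes a pair of one-parameter families of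
unitaries with a nontrivial commutator of second order to which the window is regular. -/
theorem false_of_commutator (h : IsDualWindow U g d K) {V W : ℝ → H ≃ₗᵢ[ℂ] H} {a b : ℝ → G → ℂ}
    (ha : ∀ s, a s 0 = 1) (hb : ∀ s, b s 0 = 1) (ha1 : ∀ s k, ‖a s k‖ = 1)
    (hb1 : ∀ s k, ‖b s k‖ = 1) (hbn : ∀ s k, b s k * b s (-k) = 1)
    (hV : ∀ s k x, V s (U k x) = a s k • U k (V s x))
    (hW : ∀ s k x, W s (U k x) = b s k • U k (W s x))
    (hat : ∀ k, Tendsto (fun s => a s k) (𝓝[≠] 0) (𝓝 1))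
    (hbt : ∀ k, Tendsto (fun s => b s k) (𝓝[≠] 0) (𝓝 1))
    {p : H} (hVg : Tendsto (fun s => s⁻¹ • (V s g - g)) (𝓝[≠] 0) (𝓝 p))
    {C : ℝ} (hWg : ∀ s, ‖W s g - g‖ ≤ C * |s|)
    {e : ℝ → ℂ} (hVW : ∀ s x, W s (V s x) = e s • V s (W s x))
    {κ : ℂ} (hκ : κ ≠ 0) (he : Tendsto (fun s : ℝ => (s ^ 2 : ℝ)⁻¹ • (1 - e s)) (𝓝[≠] 0) (𝓝 κ)) :
    False := by
  have hid : Tendsto (fun s : ℝ => s) (𝓝[≠] 0) (𝓝 0) := tendsto_nhdsWithin_of_tendsto_nhds tendsto_id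
  have hV0 : Tendsto (fun s => V s g) (𝓝[≠] 0) (𝓝 g) := by
    have h1 := (hid.smul hVg).add_const g
    rw [zero_smul, zero_add] at h1
    refine h1.congr' ?_
    filter_upwards [self_mem_nhdsWithin] with s hs
    rw [smul_inv_smul₀ hs, sub_add_cancel]
  have hW0 : Tendsto (fun s => ‖W s g - g‖) (𝓝[≠] 0) (𝓝 0) := by
    refine squeeze_zero (fun _ => norm_nonneg _) hWg ?_
    simpa using hid.abs.const_mul C
  have hVW0 : Tendsto (fun s => V s (W s g)) (𝓝[≠] 0) (𝓝 g) := by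
    rw [tendsto_iff_norm_sub_tendsto_zero] at hV0 ⊢
    refine squeeze_zero (fun _ => norm_nonneg _) (fun s => ?_) (by simpa using hW0.add hV0)
    rw [← sub_add_sub_cancel _ (V s g), ← map_sub]
    exact (norm_add_le _ _).trans_eq (by rw [(V s).norm_map])
  -- First evaluation: the commutator is (1 − e s) V W g, and ⟨d, V W g⟩ tends to ⟨d, g⟩ = 1.
  have hlim : Tendsto (fun s : ℝ => ‖(s ^ 2 : ℝ)⁻¹ • inner ℂ d (V s (W s g) - W s (V s g))‖ ^ 2)
      (𝓝[≠] 0) (𝓝 (‖κ‖ ^ 2)) := by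
    have h1 : Tendsto (fun s => inner ℂ d (V s (W s g))) (𝓝[≠] 0) (𝓝 (inner ℂ d g)) :=
      tendsto_const_nhds.inner hVW0
    rw [h.inner_zero] at h1
    have h2 := ((he.mul h1).norm).pow 2
    rw [mul_one] at h2
    refine h2.congr fun s => ?_
    rw [hVW, inner_sub_right, inner_smul_right, smul_mul_assoc, sub_mul, one_mul]
  -- Second evaluation: the squared commutator is at most s⁴ times a quantity tending to 0. One
  -- factor s² comes from the Lipschitz bound on W, the other from V g − g = s p + o(s).
  have hlim0 : Tendsto (fun s : ℝ => ‖(s ^ 2 : ℝ)⁻¹ • inner ℂ d (V s (W s g) - W s (V s g))‖ ^ 2)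
      (𝓝[≠] 0) (𝓝 0) := by
    have hD : Tendsto (fun s => ∑' k, ‖a s (-k) * b s (-k) - 1‖ ^ 2 * ‖inner ℂ (U k d) p‖ ^ 2)
        (𝓝[≠] 0) (𝓝 0) := by
      have h1 : Tendsto (fun s => ∑' k, ‖a s (-k) * b s (-k) - 1‖ ^ 2 * ‖inner ℂ (U k d) p‖ ^ 2)
          (𝓝[≠] 0) (𝓝 (∑' _ : G, (0 : ℝ))) := by
        refine tendsto_tsum_of_dominated_convergence ((h.summable_dual p).mul_left 4)
          (fun k => ?_) (Eventually.of_forall fun s k => ?_)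
        · have h2 := ((((hat (-k)).mul (hbt (-k))).sub_const 1).norm.pow 2).mul_const
            (‖inner ℂ (U k d) p‖ ^ 2)
          simpa using h2
        · have h1 : ‖a s (-k) * b s (-k) - 1‖ ≤ 2 := (norm_sub_le _ _).trans (by
            rw [norm_mul, ha1, hb1, norm_one]; norm_num)
          rw [Real.norm_of_nonneg (by positivity)]
          gcongr
          nlinarith [norm_nonneg (a s (-k) * b s (-k) - 1)]
      simpa using h1
    have hE : Tendsto (fun s => ‖s⁻¹ • (V s g - g) - p‖) (𝓝[≠] 0) (𝓝 0) :=
      tendsto_iff_norm_sub_tendsto_zero.1 hVg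
    have hF := ((hD.const_mul 2).add ((hE.pow 2).const_mul (8 * K))).const_mul (K ^ 3 * C ^ 2)
    simp only [mul_zero, ne_eq, OfNat.ofNat_ne_zero, not_false_eq_true, zero_pow, add_zero] at hF
    refine squeeze_zero' (Eventually.of_forall fun s => by positivity) ?_ hF
    filter_upwards [self_mem_nhdsWithin] with s hs
    have hs0 : s ≠ 0 := hs
    have hK := h.pos
    have h1 := h.norm_inner_commutator_sq_le (ha s) (hb s) (ha1 s) (hb1 s) (hbn s) (hV s) (hW s)
      (s • p)
    have h2 : ‖V s g - g - s • p‖ = |s| * ‖s⁻¹ • (V s g - g) - p‖ := by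
      rw [← Real.norm_eq_abs, ← norm_smul, smul_sub, smul_inv_smul₀ hs0]
    have h3 : ∀ k, ‖inner ℂ (U k d) (s • p)‖ ^ 2 = s ^ 2 * ‖inner ℂ (U k d) p‖ ^ 2 := fun k => by
      rw [← Complex.coe_smul, inner_smul_right, norm_mul, Complex.norm_real, mul_pow,
        Real.norm_eq_abs, sq_abs]
    simp only [h2, h3, mul_left_comm _ (s ^ 2), tsum_mul_left, mul_pow, sq_abs] at h1
    rw [norm_smul, mul_pow, norm_inv, inv_pow,
      inv_mul_le_iff₀ (pow_pos (norm_pos_iff.2 (pow_ne_zero 2 hs0)) 2), Real.norm_eq_abs,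
      sq_abs]
    refine h1.trans ?_
    have h4 : ‖W s g - g‖ ^ 2 ≤ (C * |s|) ^ 2 := by
      gcongr
      exact hWg s
    rw [mul_pow, sq_abs] at h4
    have h5 : 0 ≤ ∑' k, ‖a s (-k) * b s (-k) - 1‖ ^ 2 * ‖inner ℂ (U k d) p‖ ^ 2 :=
      tsum_nonneg fun _ => by positivity
    calc _ ≤ K ^ 3 * (C ^ 2 * s ^ 2) * _ :=
          mul_le_mul_of_nonneg_right (mul_le_mul_of_nonneg_left h4 (by positivity)) (by positivity)
      _ = _ := by ring
  have := tendsto_nhds_unique hlim hlim0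
  simp [hκ] at this

end IsDualWindow

end DualWindow


/-! ### The character t ↦ e^{2πit} -/

section UnitPhase

/-- The unimodular number `e^{2πit}`. -/
noncomputable def unitPhase (t : ℝ) : ℂ := Complex.exp (2 * Real.pi * Complex.I * (t : ℂ))

theorem unitPhase_zero : unitPhase 0 = 1 := by simp [unitPhase]

theorem unitPhase_add (s t : ℝ) : unitPhase (s + t) = unitPhase s * unitPhase t := by
  rw [unitPhase, unitPhase, unitPhase, ← Complex.exp_add]
  push_cast
  ring_nf

theorem unitPhase_intCast (n : ℤ) : unitPhase n = 1 := by
  rw [unitPhase, Complex.exp_eq_one_iff]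
  exact ⟨n, by push_cast; ring⟩

theorem unitPhase_eq (t : ℝ) : unitPhase t = Complex.exp (Complex.I * (2 * Real.pi * t : ℝ)) := by
  rw [unitPhase]
  push_cast
  ring_nf

theorem norm_unitPhase (t : ℝ) : ‖unitPhase t‖ = 1 := by
  rw [unitPhase_eq, Complex.norm_exp_I_mul_ofReal]

theorem norm_unitPhase_sub_one_le (t : ℝ) : ‖unitPhase t - 1‖ ≤ 2 * Real.pi * |t| := by
  rw [unitPhase_eq]
  refine Real.norm_exp_I_mul_ofReal_sub_one_le.trans_eq ?_
  rw [Real.norm_eq_abs, abs_mul, abs_of_pos Real.two_pi_pos]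

theorem continuous_unitPhase : Continuous unitPhase := by
  unfold unitPhase
  fun_prop

open Filter Topology in
theorem tendsto_unitPhase_slope (c : ℝ) :
    Tendsto (fun s : ℝ => s⁻¹ • (unitPhase (s * c) - 1)) (𝓝[≠] 0)
      (𝓝 (2 * Real.pi * Complex.I * c)) := by
  have h1 : HasDerivAt (fun s : ℝ => unitPhase (s * c)) (2 * Real.pi * Complex.I * c) 0 := by
    have h2 : HasDerivAt (fun s : ℝ => 2 * Real.pi * Complex.I * ((s * c : ℝ) : ℂ))
        (2 * Real.pi * Complex.I * ((1 * c : ℝ) : ℂ)) 0 :=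
      (((hasDerivAt_id (0 : ℝ)).mul_const c).ofReal_comp).const_mul _
    simpa [unitPhase] using h2.cexp
  have h3 := h1.tendsto_slope_zero
  simpa [unitPhase_zero] using h3

end UnitPhase

/-! ### Time-frequency shifts as unitaries and their Weyl relations -/

section TimeFreqShift

variable {d : ℕ}

theorem coeFn_timeFreqShift (g : L2Space d) (m n : EuclideanSpace ℝ (Fin d)) :
    timeFreqShift g m n =ᵐ[volume] fun x => unitPhase (inner ℝ n x) * g (x - m) :=
  (memLp_gaborFun g m n).coeFn_toLp

theorem ae_comp_sub {p : EuclideanSpace ℝ (Fin d) → Prop} (h : ∀ᵐ x, p x)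
    (m : EuclideanSpace ℝ (Fin d)) : ∀ᵐ x, p (x - m) :=
  (measurePreserving_sub_right volume m).quasiMeasurePreserving.ae h

theorem timeFreqShift_add (f g : L2Space d) (m n : EuclideanSpace ℝ (Fin d)) :
    timeFreqShift (f + g) m n = timeFreqShift f m n + timeFreqShift g m n := by
  refine Lp.ext ?_
  filter_upwards [coeFn_timeFreqShift (f + g) m n, coeFn_timeFreqShift f m n,
    coeFn_timeFreqShift g m n, Lp.coeFn_add (timeFreqShift f m n) (timeFreqShift g m n),
    ae_comp_sub (Lp.coeFn_add f g) m] with x h1 h2 h3 h4 h5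
  rw [h1, h4, Pi.add_apply, h2, h3, h5, Pi.add_apply, mul_add]

theorem timeFreqShift_smul (c : ℂ) (g : L2Space d) (m n : EuclideanSpace ℝ (Fin d)) :
    timeFreqShift (c • g) m n = c • timeFreqShift g m n := by
  refine Lp.ext ?_
  filter_upwards [coeFn_timeFreqShift (c • g) m n, coeFn_timeFreqShift g m n,
    Lp.coeFn_smul c (timeFreqShift g m n), ae_comp_sub (Lp.coeFn_smul c g) m] with x h1 h2 h3 h4
  rw [h1, h3, Pi.smul_apply, h2, h4, Pi.smul_apply, smul_eq_mul, smul_eq_mul, mul_left_comm]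

theorem timeFreqShift_zero (g : L2Space d) : timeFreqShift g 0 0 = g := by
  refine Lp.ext ?_
  filter_upwards [coeFn_timeFreqShift g 0 0] with x h1
  rw [h1, inner_zero_left, unitPhase_zero, one_mul, sub_zero]

theorem timeFreqShift_timeFreqShift (g : L2Space d) (m n m' n' : EuclideanSpace ℝ (Fin d)) :
    timeFreqShift (timeFreqShift g m n) m' n' =
      unitPhase (-inner ℝ n m') • timeFreqShift g (m + m') (n + n') := by
  refine Lp.ext ?_
  filter_upwards [coeFn_timeFreqShift (timeFreqShift g m n) m' n',
    ae_comp_sub (coeFn_timeFreqShift g m n) m', coeFn_timeFreqShift g (m + m') (n + n'),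
    Lp.coeFn_smul (unitPhase (-inner ℝ n m')) (timeFreqShift g (m + m') (n + n'))]
    with x h1 h2 h3 h4
  rw [h1, h2, h4, Pi.smul_apply, h3, smul_eq_mul, ← mul_assoc, ← mul_assoc, ← unitPhase_add,
    ← unitPhase_add, inner_sub_right, inner_add_left, sub_sub, add_comm m' m]
  ring_nf

theorem norm_timeFreqShift (g : L2Space d) (m n : EuclideanSpace ℝ (Fin d)) :
    ‖timeFreqShift g m n‖ = ‖g‖ := by
  rw [timeFreqShift, Lp.norm_toLp, Lp.norm_def,
    ← eLpNorm_comp_measurePreserving (Lp.aestronglyMeasurable g)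
      (measurePreserving_sub_right volume m)]
  congr 1
  refine eLpNorm_congr_norm_ae (Filter.Eventually.of_forall fun x => ?_)
  change ‖unitPhase (inner ℝ n x) * g (x - m)‖ = _
  rw [norm_mul, norm_unitPhase, one_mul]
  rfl

/-- The time-frequency shift as a unitary operator. -/
noncomputable def timeFreqUnitary (m n : EuclideanSpace ℝ (Fin d)) : L2Space d ≃ₗᵢ[ℂ] L2Space d where
  toFun g := timeFreqShift g m n
  map_add' f g := timeFreqShift_add f g m n
  map_smul' c g := timeFreqShift_smul c g m n
  invFun g := unitPhase (-inner ℝ n m) • timeFreqShift g (-m) (-n)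
  left_inv g := by
    beta_reduce
    rw [timeFreqShift_timeFreqShift, smul_smul, ← unitPhase_add, add_neg_cancel, add_neg_cancel,
      timeFreqShift_zero, inner_neg_right, neg_neg, neg_add_cancel, unitPhase_zero, one_smul]
  right_inv g := by
    beta_reduce
    rw [timeFreqShift_smul, timeFreqShift_timeFreqShift, smul_smul, ← unitPhase_add,
      neg_add_cancel, neg_add_cancel, timeFreqShift_zero, inner_neg_left, neg_neg, neg_add_cancel,
      unitPhase_zero, one_smul]
  norm_map' g := norm_timeFreqShift g m n

theorem timeFreqUnitary_apply (m n : EuclideanSpace ℝ (Fin d)) (g : L2Space d) :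
    timeFreqUnitary m n g = timeFreqShift g m n := rfl

theorem intVec_add (m n : Fin d → ℤ) : intVec (m + n) = intVec m + intVec n := by
  ext i
  simp [intVec]

theorem unitPhase_inner_intVec (m n : Fin d → ℤ) :
    unitPhase (-inner ℝ (intVec m) (intVec n)) = 1 := by
  have : -inner ℝ (intVec m) (intVec n) = ((-∑ i, n i * m i : ℤ) : ℝ) := by
    simp [intVec, PiLp.inner_apply]
  rw [this, unitPhase_intCast]

/-- The Weyl phase e^{−2πi n·m'} is trivial at integer vectors, so the projective representation is
a genuine one on the lattice. -/
theorem timeFreqUnitary_intVec_add (a b : (Fin d → ℤ) × (Fin d → ℤ)) (x : L2Space d) :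
    timeFreqUnitary (intVec (a + b).1) (intVec (a + b).2) x =
      timeFreqUnitary (intVec a.1) (intVec a.2) (timeFreqUnitary (intVec b.1) (intVec b.2) x) := by
  simp only [timeFreqUnitary_apply]
  rw [timeFreqShift_timeFreqShift, unitPhase_inner_intVec, one_smul, ← intVec_add, ← intVec_add,
    ← Prod.fst_add, ← Prod.snd_add, add_comm b a]

/-- The (positive sign) Fourier transform turns translations into modulations. -/
theorem fourierL2_timeFreqShift (g : L2Space d) (m : EuclideanSpace ℝ (Fin d)) :
    fourierL2 (timeFreqShift g m 0) = timeFreqShift (fourierL2 g) 0 m := by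
  refine DenseRange.induction_on (p := fun g : L2Space d =>
    fourierL2 (timeFreqShift g m 0) = timeFreqShift (fourierL2 g) 0 m)
    (SchwartzMap.denseRange_toLpCLM (p := 2) ENNReal.ofNat_ne_top) g ?_ fun f => ?_
  · have hF : Continuous (fourierL2 (d := d)) :=
      (Lp.fourierTransformₗᵢ (EuclideanSpace ℝ (Fin d)) ℂ).symm.continuous
    exact isClosed_eq (hF.comp (timeFreqUnitary m 0).continuous)
      ((timeFreqUnitary 0 m).continuous.comp hF)
  · have h1 : timeFreqShift (f.toLp 2) m 0 = (f.compSubConstCLM ℂ m).toLp 2 := by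
      refine Lp.ext ?_
      filter_upwards [coeFn_timeFreqShift (f.toLp 2) m 0, ae_comp_sub (f.coeFn_toLp 2 volume) m,
        (f.compSubConstCLM ℂ m).coeFn_toLp 2 volume] with x h1 h2 h3
      rw [h1, h2, h3, inner_zero_left, unitPhase_zero, one_mul, SchwartzMap.compSubConstCLM_apply]
    rw [SchwartzMap.toLpCLM_apply, h1, fourierL2, fourierL2, SchwartzMap.toLp_fourierInv_eq,
      SchwartzMap.toLp_fourierInv_eq]
    refine Lp.ext ?_
    filter_upwards [coeFn_timeFreqShift ((𝓕⁻ f).toLp 2) 0 m, (𝓕⁻ f).coeFn_toLp 2 volume,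
      (𝓕⁻ (f.compSubConstCLM ℂ m)).coeFn_toLp 2 volume] with x h1 h2 h3
    rw [h1, sub_zero, h2, h3, SchwartzMap.fourierInv_coe, SchwartzMap.fourierInv_coe,
      Real.fourierInv_eq', Real.fourierInv_eq', ← integral_const_mul,
      ← integral_sub_right_eq_self (fun y => unitPhase (inner ℝ m x) *
        (Complex.exp (((2 * Real.pi * inner ℝ y x : ℝ) : ℂ) * Complex.I) • f y)) m]
    refine integral_congr_ae (Filter.Eventually.of_forall fun y => ?_)
    simp only [SchwartzMap.compSubConstCLM_apply, smul_eq_mul]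
    rw [unitPhase, ← mul_assoc, ← Complex.exp_add, inner_sub_left]
    congr 2
    push_cast
    ring

end TimeFreqShift

/-! ### Weighted energies and regularity under modulation and translation -/

section Energy

variable {d : ℕ}

/-- Cauchy–Schwarz for the semidefinite polar form B gives B(w, x)² ≤ ω(w) ω(x). Choosing ω(w) > 0,
the vector v represents B(w, ·) / √ω(w). -/
theorem QuadraticForm.exists_inner_sq_le {E : Type*} [NormedAddCommGroup E]
    [InnerProductSpace ℝ E] [FiniteDimensional ℝ E] (ω : QuadraticForm ℝ E)
    (hω : ∀ x, 0 ≤ ω x) (hne : ω ≠ 0) : ∃ v : E, v ≠ 0 ∧ ∀ x, inner ℝ v x ^ 2 ≤ ω x := by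
  obtain ⟨w, hw⟩ : ∃ w, ω w ≠ 0 := by
    by_contra! h
    exact hne (QuadraticMap.ext h)
  have hw0 : 0 < ω w := lt_of_le_of_ne (hω w) (Ne.symm hw)
  set B := QuadraticMap.associated ω with hB
  have hBB : ∀ x, B x x = ω x := fun x => QuadraticMap.associated_eq_self_apply ℝ ω x
  let u := (InnerProductSpace.toDual ℝ E).symm (LinearMap.toContinuousLinearMap (B w))
  have hu : ∀ x, inner ℝ u x = B w x := fun x => InnerProductSpace.toDual_symm_apply
  refine ⟨(√(ω w))⁻¹ • u, fun h => ?_, fun x => ?_⟩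
  · have h1 : u = 0 := by
      simpa [hw0.le, Real.sqrt_eq_zero, hw] using h
    have h2 := hu w
    rw [h1, inner_zero_left, hBB] at h2
    exact hw h2.symm
  · have h1 := LinearMap.BilinForm.apply_sq_le_of_symm B (fun x => (hω x).trans_eq (hBB x).symm)
      ⟨QuadraticMap.associated_isSymm ℝ ω⟩ w x
    rw [hBB, hBB] at h1
    rw [real_inner_smul_left, hu, mul_pow, inv_pow, Real.sq_sqrt hw0.le, inv_mul_le_iff₀ hw0]
    exact h1

theorem weightedEnergy_ne_zero {ω : QuadraticForm ℝ (EuclideanSpace ℝ (Fin d))}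
    {v : EuclideanSpace ℝ (Fin d)} (hv : v ≠ 0) (hω : ∀ x, inner ℝ v x ^ 2 ≤ ω x)
    {f : L2Space d} (hf : f ≠ 0) : weightedEnergy ω f ≠ 0 := by
  intro h
  apply hf
  have h0 : ∫⁻ x, ENNReal.ofReal (inner ℝ v x ^ 2 * ‖f x‖ ^ 2) = 0 := by
    refine le_antisymm (h ▸ lintegral_mono fun x => ?_) bot_le
    exact ENNReal.ofReal_le_ofReal (mul_le_mul_of_nonneg_right (hω x) (by positivity))
  have hmeas : Measurable f := (Lp.stronglyMeasurable f).measurable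
  rw [lintegral_eq_zero_iff (by fun_prop)] at h0
  -- The weight ⟨v, x⟩² vanishes only on a hyperplane, a null set.
  have hker : volume ((LinearMap.ker (innerSL ℝ v).toLinearMap : Submodule ℝ _) :
      Set (EuclideanSpace ℝ (Fin d))) = 0 := by
    refine Measure.addHaar_submodule _ _ fun htop => hv ?_
    have : v ∈ LinearMap.ker (innerSL ℝ v).toLinearMap := htop ▸ Submodule.mem_top
    simpa using this
  refine (Lp.eq_zero_iff_ae_eq_zero).2 ?_
  filter_upwards [h0, measure_eq_zero_iff_ae_notMem.1 hker] with x h1 h2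
  have h3 : inner ℝ v x ≠ 0 := by simpa using h2
  have h4 : inner ℝ v x ^ 2 * ‖f x‖ ^ 2 ≤ 0 := ENNReal.ofReal_eq_zero.1 h1
  have h5 : 0 < inner ℝ v x ^ 2 := by positivity
  by_contra h6
  have : 0 < ‖f x‖ ^ 2 := pow_pos (norm_pos_iff.2 h6) 2
  nlinarith

theorem memLp_inner_mul {ω : QuadraticForm ℝ (EuclideanSpace ℝ (Fin d))}
    {v : EuclideanSpace ℝ (Fin d)} (hω : ∀ x, inner ℝ v x ^ 2 ≤ ω x)
    {f : L2Space d} (hf : weightedEnergy ω f ≠ ∞) :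
    MemLp (fun x => (2 * Real.pi * Complex.I * (inner ℝ v x : ℝ)) * f x) 2 volume := by
  have hmeas : Measurable f := (Lp.stronglyMeasurable f).measurable
  have hc : MemLp (fun x => ((inner ℝ v x : ℝ) : ℂ) * f x) 2 volume := by
    refine (memLp_two_iff_integrable_sq_norm (by fun_prop)).2 ⟨by fun_prop, ?_⟩
    rw [hasFiniteIntegral_iff_ofReal (Filter.Eventually.of_forall fun x => by positivity)]
    refine lt_of_le_of_lt (lintegral_mono fun x => ?_) (lt_top_iff_ne_top.2 hf)
    rw [norm_mul, Complex.norm_real, mul_pow, Real.norm_eq_abs, sq_abs]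
    exact ENNReal.ofReal_le_ofReal (mul_le_mul_of_nonneg_right (hω x) (by positivity))
  simpa only [mul_assoc] using hc.const_mul (2 * Real.pi * Complex.I)

theorem coeFn_modulation_sub (f : L2Space d) (v : EuclideanSpace ℝ (Fin d)) (s : ℝ) :
    (timeFreqShift f 0 (s • v) - f : L2Space d) =ᵐ[volume]
      fun x => (unitPhase (s * inner ℝ v x) - 1) * f x := by
  filter_upwards [coeFn_timeFreqShift f 0 (s • v), Lp.coeFn_sub (timeFreqShift f 0 (s • v)) f]
    with x h1 h2
  rw [h2, Pi.sub_apply, h1, sub_zero, real_inner_smul_left, sub_mul, one_mul]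

theorem norm_modulation_sub_le {f : L2Space d} {v : EuclideanSpace ℝ (Fin d)}
    (hf : MemLp (fun x => (2 * Real.pi * Complex.I * (inner ℝ v x : ℝ)) * f x) 2 volume) (s : ℝ) :
    ‖timeFreqShift f 0 (s • v) - f‖ ≤ ‖hf.toLp _‖ * |s| := by
  rw [mul_comm]
  refine Lp.norm_le_mul_norm_of_ae_le_mul ?_
  filter_upwards [coeFn_modulation_sub f v s, hf.coeFn_toLp] with x h1 h2
  rw [h1, h2, norm_mul, norm_mul, ← mul_assoc]
  refine mul_le_mul_of_nonneg_right ((norm_unitPhase_sub_one_le _).trans_eq ?_) (norm_nonneg _)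
  simp [abs_mul, abs_of_pos Real.pi_pos]
  ring

/-- By Plancherel, translating f amounts to modulating its Fourier transform. -/
theorem norm_translation_sub_le {f : L2Space d} {v : EuclideanSpace ℝ (Fin d)}
    (hf : MemLp (fun x => (2 * Real.pi * Complex.I * (inner ℝ v x : ℝ)) * fourierL2 f x) 2 volume)
    (s : ℝ) : ‖timeFreqShift f (s • v) 0 - f‖ ≤ ‖hf.toLp _‖ * |s| := by
  refine le_of_eq_of_le ?_ (norm_modulation_sub_le hf s)
  rw [← fourierL2_timeFreqShift]
  have := (Lp.fourierTransformₗᵢ (EuclideanSpace ℝ (Fin d)) ℂ).symm.norm_map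
    (timeFreqShift f (s • v) 0 - f)
  rw [map_sub] at this
  exact this.symm

theorem norm_sq_eq_lintegral (f : L2Space d) : ‖f‖ ^ 2 = (∫⁻ x, ‖f x‖ₑ ^ 2).toReal := by
  rw [Lp.norm_def, eLpNorm_eq_lintegral_rpow_enorm_toReal (by norm_num) (by norm_num),
    ← ENNReal.toReal_pow, ← ENNReal.rpow_natCast, ← ENNReal.rpow_mul]
  norm_num

-- The difference quotients converge pointwise to q = 2πi⟨v, x⟩ f and are dominated by |q|, so their
-- squared distances to q have the integrable majorant (2|q|)².
open Filter Topology in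
theorem tendsto_modulation {f : L2Space d} {v : EuclideanSpace ℝ (Fin d)}
    (hf : MemLp (fun x => (2 * Real.pi * Complex.I * (inner ℝ v x : ℝ)) * f x) 2 volume) :
    Tendsto (fun s : ℝ => s⁻¹ • (timeFreqShift f 0 (s • v) - f)) (𝓝[≠] 0) (𝓝 (hf.toLp _)) := by
  have hmeas : Measurable f := (Lp.stronglyMeasurable f).measurable
  have hph := continuous_unitPhase.measurable
  let q : EuclideanSpace ℝ (Fin d) → ℂ :=
    fun x => (2 * Real.pi * Complex.I * (inner ℝ v x : ℝ)) * f x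
  let F : ℝ → EuclideanSpace ℝ (Fin d) → ℂ := fun s x =>
    (s⁻¹ • (unitPhase (s * inner ℝ v x) - 1)) * f x - q x
  have hF : ∀ s, (s⁻¹ • (timeFreqShift f 0 (s • v) - f) - hf.toLp _ : L2Space d) =ᵐ[volume] F s :=
    fun s => by
      filter_upwards [Lp.coeFn_sub (s⁻¹ • (timeFreqShift f 0 (s • v) - f)) (hf.toLp _),
        Lp.coeFn_smul s⁻¹ (timeFreqShift f 0 (s • v) - f), coeFn_modulation_sub f v s,
        hf.coeFn_toLp] with x h1 h2 h3 h4
      rw [h1, Pi.sub_apply, h2, Pi.smul_apply, h3, h4, ← smul_mul_assoc]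
  have hlim : Tendsto (fun s => ∫⁻ x, ‖F s x‖ₑ ^ 2) (𝓝[≠] 0)
      (𝓝 (∫⁻ _ : EuclideanSpace ℝ (Fin d), 0)) := by
    refine tendsto_lintegral_filter_of_dominated_convergence (fun x => (2 * ‖q x‖ₑ) ^ 2)
      (Eventually.of_forall fun s => by fun_prop) ?_ ?_ ?_
    · refine Eventually.of_forall fun s => Eventually.of_forall fun x => ?_
      have h1 : ‖F s x‖ ≤ 2 * ‖q x‖ := by
        refine (norm_sub_le _ _).trans ?_
        rw [two_mul]
        gcongr
        simp only [q]
        rw [norm_mul, norm_mul]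
        refine mul_le_mul_of_nonneg_right ?_ (norm_nonneg _)
        rw [norm_smul, norm_inv]
        -- The bound is needed for all s; at s = 0 the convention 0⁻¹ = 0 makes the quotient vanish.
        rcases eq_or_ne s 0 with rfl | hs
        · simp
        rw [inv_mul_le_iff₀ (norm_pos_iff.2 hs)]
        refine (norm_unitPhase_sub_one_le _).trans_eq ?_
        simp [abs_mul, abs_of_pos Real.pi_pos]
        ring
      gcongr
      rw [← ofReal_norm, ← ofReal_norm, ← ENNReal.ofReal_ofNat 2,
        ← ENNReal.ofReal_mul (by norm_num)]
      exact ENNReal.ofReal_le_ofReal h1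
    · have h1 : eLpNorm q 2 volume < ∞ := hf.eLpNorm_lt_top
      simp_rw [mul_pow]
      rw [lintegral_const_mul' _ _ (by norm_num)]
      refine ENNReal.mul_ne_top (by norm_num) ?_
      have h2 := lintegral_rpow_enorm_lt_top_of_eLpNorm_lt_top (by norm_num) (by norm_num) h1
      simpa using h2.ne
    · refine Eventually.of_forall fun x => ?_
      have h1 : Tendsto (fun s => F s x) (𝓝[≠] 0) (𝓝 0) := by
        have := ((tendsto_unitPhase_slope (inner ℝ v x)).mul_const (f x)).sub_const (q x)
        simpa [F, q] using this
      have h2 := ((ENNReal.continuous_pow 2).tendsto _).comp h1.enorm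
      simpa [Function.comp_def] using h2
  rw [tendsto_iff_norm_sub_tendsto_zero]
  have h2 : Tendsto (fun s => √(∫⁻ x, ‖F s x‖ₑ ^ 2).toReal) (𝓝[≠] 0) (𝓝 0) := by
    rw [lintegral_zero] at hlim
    have := ((ENNReal.tendsto_toReal ENNReal.zero_ne_top).comp hlim).sqrt
    simpa using this
  refine h2.congr fun s => ?_
  rw [← Real.sqrt_sq (norm_nonneg (s⁻¹ • (timeFreqShift f 0 (s • v) - f) - hf.toLp _)),
    norm_sq_eq_lintegral]
  congr 2
  refine lintegral_congr_ae ?_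
  filter_upwards [hF s] with x hx
  rw [hx]

end Energy

/-! ### The Balian–Low theorem for a quadratic weight -/

open Filter Topology in
theorem corollaryt3 (d : ℕ) (ω : QuadraticForm ℝ (EuclideanSpace ℝ (Fin d)))
    (hω_nonneg : ∀ x, 0 ≤ ω x) (hω_ne : ω ≠ 0)
    (g : L2Space d) (hg : IsExactFrame (gaborSystem g)) :
    weightedEnergy ω g * weightedEnergy ω (fourierL2 g) = ∞ := by
  obtain ⟨v, hv, hvω⟩ := ω.exists_inner_sq_le hω_nonneg hω_ne
  let U : (Fin d → ℤ) × (Fin d → ℤ) → L2Space d ≃ₗᵢ[ℂ] L2Space d :=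
    fun p => timeFreqUnitary (intVec p.1) (intVec p.2)
  obtain ⟨γ, K, hγ⟩ := IsExactFrame.exists_isDualWindow (U := U) timeFreqUnitary_intVec_add hg
  have hg0 : g ≠ 0 := fun h => by simpa [h] using hγ.inner_zero
  have hg0' : fourierL2 g ≠ 0 := fun h =>
    hg0 ((Lp.fourierTransformₗᵢ (EuclideanSpace ℝ (Fin d)) ℂ).symm.map_eq_zero_iff.1 h)
  have hpos := weightedEnergy_ne_zero hv hvω hg0
  have hpos' := weightedEnergy_ne_zero hv hvω hg0'
  -- Both energies are nonzero, so a product different from ∞ forces both to be finite.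
  by_contra hfin
  have hx : weightedEnergy ω g ≠ ∞ := fun h => hfin (by rw [h, ENNReal.top_mul hpos'])
  have hξ : weightedEnergy ω (fourierL2 g) ≠ ∞ := fun h => hfin (by rw [h, ENNReal.mul_top hpos])
  have hq := memLp_inner_mul hvω hx
  have hq' := memLp_inner_mul hvω hξ
  have hid : Tendsto (fun s : ℝ => s) (𝓝[≠] 0) (𝓝 0) := tendsto_nhdsWithin_of_tendsto_nhds tendsto_id
  have hphase : ∀ c : ℝ, Tendsto (fun s : ℝ => unitPhase (s * c)) (𝓝[≠] 0) (𝓝 1) := fun c => by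
    have h1 := (continuous_unitPhase.tendsto 0).comp
      (show Tendsto (fun s : ℝ => s * c) (𝓝[≠] 0) (𝓝 0) by simpa using hid.mul_const c)
    rwa [unitPhase_zero] at h1
  have hzero : intVec (0 : Fin d → ℤ) = 0 := by ext i; simp [intVec]
  have hneg : ∀ m : Fin d → ℤ, intVec (-m) = -intVec m := fun m => by ext i; simp [intVec]
  -- Modulation by sv passes the lattice shift (m, n) with phase e^{2πi s⟨v, m⟩}, translation by sv
  -- with e^{−2πi s⟨v, n⟩}. Exchanging the two with each other costs e^{−2πi s²|v|²}, whence κ =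
  -- 2πi|v|².
  refine hγ.false_of_commutator (V := fun s => timeFreqUnitary 0 (s • v))
    (W := fun s => timeFreqUnitary (s • v) 0)
    (a := fun s p => unitPhase (s * inner ℝ v (intVec p.1)))
    (b := fun s p => unitPhase (s * -inner ℝ v (intVec p.2)))
    (e := fun s => unitPhase (s ^ 2 * -inner ℝ v v)) (κ := 2 * Real.pi * Complex.I * inner ℝ v v)
    (fun s => ?_) (fun s => ?_) (fun s k => norm_unitPhase _) (fun s k => norm_unitPhase _)
    (fun s k => ?_) (fun s k x => ?_) (fun s k x => ?_) (fun k => hphase _) (fun k => hphase _)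
    (tendsto_modulation hq) (norm_translation_sub_le hq') (fun s x => ?_) ?_ ?_
  · simp [hzero, unitPhase_zero]
  · simp [hzero, unitPhase_zero]
  · rw [← unitPhase_add]
    simp [hneg, unitPhase_zero]
  · simp only [U, timeFreqUnitary_apply]
    rw [timeFreqShift_timeFreqShift, timeFreqShift_timeFreqShift, smul_smul, ← unitPhase_add,
      inner_zero_right, neg_zero, unitPhase_zero, one_smul, real_inner_smul_left, add_neg_cancel,
      unitPhase_zero, one_smul, add_zero, zero_add, add_comm (s • v)]
  · simp only [U, timeFreqUnitary_apply]
    rw [timeFreqShift_timeFreqShift, timeFreqShift_timeFreqShift, inner_zero_left, neg_zero,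
      unitPhase_zero, one_smul, real_inner_smul_right, real_inner_comm, zero_add, add_zero,
      mul_neg, add_comm (s • v)]
  · simp only [timeFreqUnitary_apply]
    rw [timeFreqShift_timeFreqShift, timeFreqShift_timeFreqShift, inner_zero_left, neg_zero,
      unitPhase_zero, one_smul, real_inner_smul_left, real_inner_smul_right, zero_add, add_zero]
    ring_nf
  · simp [hv, Real.pi_ne_zero, Complex.I_ne_zero]
  · have hsq : Tendsto (fun s : ℝ => s ^ 2) (𝓝[≠] 0) (𝓝[≠] 0) := by
      refine tendsto_nhdsWithin_iff.2 ⟨by simpa using hid.pow 2, ?_⟩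
      filter_upwards [self_mem_nhdsWithin] with s hs
      exact pow_ne_zero 2 hs
    have h1 := ((tendsto_unitPhase_slope (-inner ℝ v v)).comp hsq).neg
    simp only [Complex.ofReal_neg, mul_neg, neg_neg] at h1
    refine h1.congr fun s => ?_
    simp only [Function.comp_apply, ← smul_neg, neg_sub]
    simp
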